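/- Let $m\ge 0$ and let $K$ be a simplicial complex on the vertex set $[m]=\{1,\dots,m\}$ which is a simplicial manifold, i.e. its geometric realization $|K|$ is a (closed) topological manifold, of dimension $n-1$. Let $I^m=[0,1]^m\subset\mathbb R^m$ and, for $I\subset J\subset[m]$, let $F_{I\subset J}=\{y\in I^m: y_i=0\ (i\in I),\ y_j=1\ (j\notin J)\}$. Put $$\mathrm{cub}(K)=\bigcup_{\varnothing\ne I\subset J\in K}F_{I\subset J},\qquad \mathrm{cc}(K)=\bigcup_{I\subset J\in K}F_{I\subset J}$$ (where $\varnothing\in K$). Let $(D^2)^m\subset\mathbb C^m$ be the unit polydisk, on which the torus $T^m$ acts by coordinatewise rotations, let $\rho:(D^2)^m\to I^m$, $\rho(z)=(|z_1|^2,\dots,|z_m|^2)$, be the orbit map, and let $\mathcal W_K=\rho^{-1}(\mathrm{cub}(K))$ and $\mathcal Z_K=\rho^{-1}(\mathrm{cc}(K))$ be the moment-angle complexes. Let $p=(1,\dots,1)$, the vertex of the cone $\mathrm{cc}(K)\cong|\mathrm{cone}(K)|$, and identify $T^m$ with $\rho^{-1}(p)\subset\mathcal Z_K$. For $0<\varepsilon<1$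 let $U_\varepsilon(p)=\{y\in\mathrm{cc}(K):\|y-p\|<\varepsilon\}$ (Euclidean norm), and put $$W_K=\mathcal Z_K\setminus\rho^{-1}(U_\varepsilon(p)),\qquad \partial W_K=\{z\in\mathcal Z_K:\|\rho(z)-p\|=\varepsilon\}.$$ Then, for every $0<\varepsilon<1$: 1. $W_K$ is a topological manifold with boundary, of dimension $m+n$, with boundary $\partial W_K$, and it is $T^m$-equivariantly homotopy equivalent to the moment-angle complex $\mathcal W_K$. 2. There is a canonical relative isomorphism of pairs $(W_K,\partial W_K)\to(\mathcal Z_K,T^m)$: there is a map $c$, the same for all simplicial manifolds $K$ on $[m]$, that restricts to a continuous $T^m$-equivariant map of pairs $(W_K,\partial W_K)\to(\mathcal Z_K,T^m)$ which maps $W_K\setminus\partial W_K$ homeomorphically onto $\mathcal Z_K\setminus T^m$. Moreover $\rho(c(z))$ lies on the segment $[p,\rho(z)]$ for every $z\in W_K$, $c$ is the identity on $\mathcal W_K$, and for some $T^m$-equivariant homeomorphism $|K|\times T^m\cong\partial W_K$ the restriction of $c$ to $\partial W_K$ is the projection $|K|\times T^m\to T^m$. -/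

import Mathlib

open scoped Manifold

/-! ### General topology: manifolds, equivariant homotopy, relative homeomorphisms -/

/-- A topological manifold (without boundary) of dimension `d`. -/
def IsTopologicalManifold (d : ℕ) (X : Type*) [TopologicalSpace X] : Prop :=
  T2Space X ∧ SecondCountableTopology X ∧
    Nonempty (ChartedSpace (EuclideanSpace ℝ (Fin d)) X)

/-- `X` is a topological manifold with boundary, of dimension `n`, whose boundary is the subset
`B`: it is Hausdorff and second countable and has an atlas of charts in the Euclidean half-space
in which the points of `B`, and no others, lie on the bounding hyperplane. -/
def IsTopologicalManifoldWithBoundary (n : ℕ) [NeZero n] (X : Type*) [TopologicalSpace X]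
    (B : Set X) : Prop :=
  T2Space X ∧ SecondCountableTopology X ∧
    ∃ _ : ChartedSpace (EuclideanHalfSpace n) X, (𝓡∂ n).boundary X = B

/-- `X` and `Y` are `G`-equivariantly homotopy equivalent: there are mutually inverse homotopy
equivalences that commute with the `G`-actions, through homotopies that do so at all times. -/
def EquivariantlyHomotopyEquivalent (G X Y : Type*) [TopologicalSpace X] [TopologicalSpace Y]
    [SMul G X] [SMul G Y] : Prop :=
  ∃ (f : C(X, Y)) (g : C(Y, X))
    (H : (g.comp f).Homotopy (ContinuousMap.id X))
    (H' : (f.comp g).Homotopy (ContinuousMap.id Y)),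
    (∀ (a : G) (x : X), f (a • x) = a • f x) ∧
    (∀ (a : G) (y : Y), g (a • y) = a • g y) ∧
    (∀ (a : G) (s : unitInterval) (x : X), H (s, a • x) = a • H (s, x)) ∧
    (∀ (a : G) (s : unitInterval) (y : Y), H' (s, a • y) = a • H' (s, y))

/-- `f` is a relative homeomorphism (relative isomorphism) of pairs `(X, A) → (Y, B)`: a
continuous map of pairs that restricts to a homeomorphism from `X \ A` onto `Y \ B`. -/
structure IsRelativeHomeomorph {α β : Type*} [TopologicalSpace α] [TopologicalSpace β]
    (f : α → β) (X A : Set α) (Y B : Set β) : Prop where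
  continuousOn : ContinuousOn f X
  mapsTo : Set.MapsTo f X Y
  mapsTo_sub : Set.MapsTo f A B
  homeomorph : ∃ h : ↥(X \ A) ≃ₜ ↥(Y \ B), ∀ x : ↥(X \ A), (h x : β) = f x

namespace MomentAngle

/-! ### Simplicial complexes on `[m]` and cubical complexes in the unit cube

Mathlib's `PreAbstractSimplicialComplex (Fin m)` lists the nonempty simplices of a simplicial
complex on `m` vertices; the empty set is always a simplex as well. -/

variable {m : ℕ}

/-- The simplices of `K`, the empty one included. -/
def IsSimplex (K : PreAbstractSimplicialComplex (Fin m)) (J : Finset (Fin m)) : Prop :=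
  J = ∅ ∨ J ∈ K

/-- The geometric realization `|K|`, in barycentric coordinates. -/
def realization (K : PreAbstractSimplicialComplex (Fin m)) : Set (Fin m → ℝ) :=
  {b | (∀ i, 0 ≤ b i) ∧ ∑ i, b i = 1 ∧ Finset.univ.filter (fun i => b i ≠ 0) ∈ K}

/-- The face `F_{I ⊆ J}` of the unit cube `[0,1]^m` in `ℝ^m`. -/
def face (I J : Finset (Fin m)) : Set (EuclideanSpace ℝ (Fin m)) :=
  {y | (∀ i, 0 ≤ y i ∧ y i ≤ 1) ∧ (∀ i ∈ I, y i = 0) ∧ ∀ j ∉ J, y j = 1}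

/-- The cubical complex `cub(K)`: the union of the faces `F_{I ⊆ J}`, `∅ ≠ I ⊆ J ∈ K`. -/
def cub (K : PreAbstractSimplicialComplex (Fin m)) : Set (EuclideanSpace ℝ (Fin m)) :=
  {y | ∃ I J : Finset (Fin m), I.Nonempty ∧ I ⊆ J ∧ IsSimplex K J ∧ y ∈ face I J}

/-- The cubical complex `cc(K)`: the union of the faces `F_{I ⊆ J}`, `I ⊆ J ∈ K`. -/
def cc (K : PreAbstractSimplicialComplex (Fin m)) : Set (EuclideanSpace ℝ (Fin m)) :=
  {y | ∃ I J : Finset (Fin m), I ⊆ J ∧ IsSimplex K J ∧ y ∈ face I J}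

/-- The vertex `p = (1, …, 1)` of the cube, which is the vertex of the cone `cc(K)`. -/
noncomputable def apex (m : ℕ) : EuclideanSpace ℝ (Fin m) := WithLp.toLp 2 fun _ => 1

/-! ### Moment-angle complexes -/

/-- The torus `T^m`; it acts on `ℂ^m` by coordinatewise rotations. -/
abbrev Torus (m : ℕ) : Type := Fin m → Circle

/-- The orbit map `ρ (z_1, …, z_m) = (|z_1|², …, |z_m|²)`. -/
noncomputable def orbitMap (z : Fin m → ℂ) : EuclideanSpace ℝ (Fin m) :=
  WithLp.toLp 2 fun i => ‖z i‖ ^ 2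

theorem orbitMap_smul (t : Torus m) (z : Fin m → ℂ) : orbitMap (t • z) = orbitMap z := by
  ext i
  have h : ‖(t • z) i‖ = ‖z i‖ := by
    rw [Pi.smul_apply', Circle.smul_def, norm_smul, Circle.norm_coe, one_mul]
  simp only [orbitMap, h]

/-- The preimage of `C` under the orbit map `ρ : (D²)^m → [0,1]^m` from the unit polydisk,
as a torus-invariant subset of `ℂ^m`. -/
noncomputable def ma (C : Set (EuclideanSpace ℝ (Fin m))) :
    SubMulAction (Torus m) (Fin m → ℂ) where
  carrier := {z | (∀ i, ‖z i‖ ≤ 1) ∧ orbitMap z ∈ C}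
  smul_mem' t z hz := by
    refine ⟨fun i => ?_, ?_⟩
    · rw [Pi.smul_apply', Circle.smul_def, norm_smul, Circle.norm_coe, one_mul]
      exact hz.1 i
    · simpa only [orbitMap_smul] using hz.2

/-- The moment-angle complex `𝒵_K`. -/
noncomputable def momentAngleZ (K : PreAbstractSimplicialComplex (Fin m)) :
    SubMulAction (Torus m) (Fin m → ℂ) := ma (cc K)

/-- The moment-angle complex `𝒲_K`. -/
noncomputable def momentAngleW (K : PreAbstractSimplicialComplex (Fin m)) :
    SubMulAction (Torus m) (Fin m → ℂ) := ma (cub K)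

/-- The torus `ρ⁻¹(p)`, which lies in every `𝒵_K`. -/
noncomputable def singularTorus (m : ℕ) : SubMulAction (Torus m) (Fin m → ℂ) := ma {apex m}

/-- `W_K`: the complement in `𝒵_K` of the invariant neighbourhood `ρ⁻¹(U_ε(p))` of the torus
`ρ⁻¹(p)`, where `U_ε(p)` is the open Euclidean `ε`-neighbourhood of `p` in `cc(K)`. -/
noncomputable def manifoldW (K : PreAbstractSimplicialComplex (Fin m)) (ε : ℝ) :
    SubMulAction (Torus m) (Fin m → ℂ) := ma (cc K \ Metric.ball (apex m) ε)

/-- `∂W_K`: the part of `𝒵_K` over the points of `cc(K)` at distance exactly `ε` from `p`. -/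
noncomputable def boundaryW (K : PreAbstractSimplicialComplex (Fin m)) (ε : ℝ) :
    SubMulAction (Torus m) (Fin m → ℂ) := ma (cc K ∩ Metric.sphere (apex m) ε)

end MomentAngle

/-! Everything is expressed through the depths `x i = 1 - ‖z i‖ ^ 2`, which are coordinates on the
cube centred at the apex. In them `cc K` is the part of the cone over `|K|` where the sup norm is at
most 1. Its base `cub K` is the part of sup norm exactly 1, i.e. where some `z i` vanishes
(`mem_momentAngleZ_iff`, `mem_momentAngleW_iff`, `norm_depth_eq_one_iff`). The Euclidean norm
dominates the sup norm, so for `ε < 1` the base lies strictly outside the `ε`-sphere.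

The collapse and the retraction move points along rays of the cone and keep the arguments of the `z
i` (`radial`). The depths are torus-invariant, so equivariance is automatic. The only danger is `z i
= 0`, where there is no argument to keep; such points lie on the base, where every factor used
equals 1. The collapse stretches the segment from the `ε`-sphere to the base affinely onto the
segment from the apex to the base. The homotopy equivalence pushes outwards to the base. Over the
`ε`-sphere no coordinate vanishes, so the arguments split off a factor `T^m`.

For the manifold structure, near `z i ≠ 0` the depth and the argument are local coordinates of the
plane. Near `z i = 0` the plane is shifted so that its first coordinate is positive, like the depth
it replaces (`exists_cone_chart`). Hence `W_K` is locally the cone outside the `ε`-ball times `ℝ^m`,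
that is `|K| × [0, ∞) × ℝ^m` (`coneHomeomorph`), and charts of `|K|` finish the proof. -/

namespace MomentAngle

open Set Topology

variable {m : ℕ}

/-! ### Depth coordinates -/

/-- The coordinates `1 - |z_i|²` of the orbit of `z`, measured from the apex of the cone. -/
noncomputable def depth (z : Fin m → ℂ) (i : Fin m) : ℝ := 1 - ‖z i‖ ^ 2

/-- The Euclidean norm on `Fin m → ℝ`. -/
noncomputable def l2 (x : Fin m → ℝ) : ℝ := ‖WithLp.toLp 2 x‖

/-- The open cone over `|K|`, without its vertex: the nonzero nonnegative vectors whose support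
is a simplex of `K`. -/
def openCone (K : PreAbstractSimplicialComplex (Fin m)) : Set (Fin m → ℝ) :=
  {x | (∀ i, 0 ≤ x i) ∧ Finset.univ.filter (fun i => x i ≠ 0) ∈ K}

theorem continuous_depth : Continuous (depth : (Fin m → ℂ) → Fin m → ℝ) := by
  unfold depth; fun_prop

theorem continuous_l2 : Continuous (l2 : (Fin m → ℝ) → ℝ) := by
  unfold l2; fun_prop

theorem l2_smul (a : ℝ) (ha : 0 ≤ a) (x : Fin m → ℝ) : l2 (a • x) = a * l2 x := by
  simp [l2, norm_smul, abs_of_nonneg ha]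

theorem l2_nonneg (x : Fin m → ℝ) : 0 ≤ l2 x := norm_nonneg _

theorem l2_eq_zero {x : Fin m → ℝ} : l2 x = 0 ↔ x = 0 := by
  simp [l2]

theorem abs_apply_le_l2 (x : Fin m → ℝ) (i : Fin m) : |x i| ≤ l2 x :=
  PiLp.norm_apply_le (WithLp.toLp 2 x) i

/-- Two norms are in play: the sup norm `‖x‖` measures the position relative to the base of the
cone, `l2` the distance from the apex. This comparison is what places the base outside the
`ε`-sphere. -/
theorem norm_le_l2 (x : Fin m → ℝ) : ‖x‖ ≤ l2 x :=
  (pi_norm_le_iff_of_nonneg (l2_nonneg x)).2 fun i => abs_apply_le_l2 x i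

theorem apply_le_norm (x : Fin m → ℝ) (i : Fin m) : x i ≤ ‖x‖ :=
  (le_abs_self _).trans (norm_le_pi_norm x i)

theorem dist_orbitMap_apex (z : Fin m → ℂ) : dist (orbitMap z) (apex m) = l2 (depth z) := by
  rw [dist_eq_norm, ← norm_neg, l2]
  congr 1
  ext i
  simp [orbitMap, apex, depth]

theorem norm_smul_apply (t : Torus m) (z : Fin m → ℂ) (i : Fin m) : ‖(t • z) i‖ = ‖z i‖ := by
  rw [Pi.smul_apply', Circle.smul_def, norm_smul, Circle.norm_coe, one_mul]

theorem depth_smul (t : Torus m) (z : Fin m → ℂ) : depth (t • z) = depth z := by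
  ext i
  rw [depth, norm_smul_apply, depth]

theorem depth_le_one (z : Fin m → ℂ) (i : Fin m) : depth z i ≤ 1 := by
  simp only [depth]; nlinarith [sq_nonneg ‖z i‖]

theorem depth_nonneg_iff {z : Fin m → ℂ} {i : Fin m} : 0 ≤ depth z i ↔ ‖z i‖ ≤ 1 := by
  simp only [depth, sub_nonneg]
  exact sq_le_one_iff₀ (norm_nonneg _)

theorem depth_eq_one_iff {z : Fin m → ℂ} {i : Fin m} : depth z i = 1 ↔ z i = 0 := by
  simp [depth]

theorem mem_of_subset {K : PreAbstractSimplicialComplex (Fin m)} {I J : Finset (Fin m)}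
    (hJ : J ∈ K) (h : I ⊆ J) (hI : I.Nonempty) : I ∈ K :=
  (K.isRelLowerSet_faces hJ).2 h hI

theorem nonempty_of_mem {K : PreAbstractSimplicialComplex (Fin m)} {J : Finset (Fin m)}
    (hJ : J ∈ K) : J.Nonempty := (K.isRelLowerSet_faces hJ).1

variable {K : PreAbstractSimplicialComplex (Fin m)}

theorem ne_zero_of_mem_openCone {x : Fin m → ℝ} (hx : x ∈ openCone K) : x ≠ 0 := by
  rintro rfl
  simpa using nonempty_of_mem hx.2

theorem l2_pos_of_mem_openCone {x : Fin m → ℝ} (hx : x ∈ openCone K) : 0 < l2 x :=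
  (l2_nonneg x).lt_of_ne fun h => ne_zero_of_mem_openCone hx (l2_eq_zero.1 h.symm)

theorem norm_pos_of_mem_openCone {x : Fin m → ℝ} (hx : x ∈ openCone K) : 0 < ‖x‖ :=
  norm_pos_iff.2 (ne_zero_of_mem_openCone hx)

theorem sum_pos_of_mem_openCone {x : Fin m → ℝ} (hx : x ∈ openCone K) : 0 < ∑ i, x i := by
  refine (Finset.sum_nonneg fun i _ => hx.1 i).lt_of_ne fun h => ne_zero_of_mem_openCone hx ?_
  ext i
  exact (Finset.sum_eq_zero_iff_of_nonneg fun i _ => hx.1 i).1 h.symm i (Finset.mem_univ i)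

theorem smul_mem_openCone {x : Fin m → ℝ} (hx : x ∈ openCone K) {a : ℝ} (ha : 0 < a) :
    a • x ∈ openCone K := by
  refine ⟨fun i => mul_nonneg ha.le (hx.1 i), ?_⟩
  simpa [ha.ne'] using hx.2

theorem exists_apply_eq_norm {x : Fin m → ℝ} (hx : x ∈ openCone K) : ∃ i, x i = ‖x‖ := by
  obtain ⟨j, -⟩ := nonempty_of_mem hx.2
  have : Nonempty (Fin m) := ⟨j⟩
  obtain ⟨i, hi⟩ := Finite.exists_max x
  refine ⟨i, (apply_le_norm x i).antisymm ((pi_norm_le_iff_of_nonneg (hx.1 i)).2 fun k => ?_)⟩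
  rw [Real.norm_of_nonneg (hx.1 k)]
  exact hi k

theorem norm_depth_le_one {z : Fin m → ℂ} (hz : depth z ∈ openCone K) : ‖depth z‖ ≤ 1 := by
  obtain ⟨i, hi⟩ := exists_apply_eq_norm hz
  exact hi ▸ depth_le_one z i

/-- On the cone the sup norm is attained by a coordinate, and a depth equals 1 only at `z i = 0`. So
the points without a well-defined argument are exactly those over the base. -/
theorem norm_depth_eq_one_iff {z : Fin m → ℂ} (hz : depth z ∈ openCone K) :
    ‖depth z‖ = 1 ↔ ∃ i, z i = 0 := by
  constructor
  · intro h
    obtain ⟨i, hi⟩ := exists_apply_eq_norm hz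
    exact ⟨i, depth_eq_one_iff.1 (hi.trans h)⟩
  · rintro ⟨i, hi⟩
    exact (norm_depth_le_one hz).antisymm ((depth_eq_one_iff.2 hi).symm.le.trans (apply_le_norm _ _))

/-! ### The moment-angle complexes in depth coordinates -/

theorem mem_face_iff {I J : Finset (Fin m)} {z : Fin m → ℂ} :
    orbitMap z ∈ face I J ↔
      (∀ i, ‖z i‖ ≤ 1) ∧ (∀ i ∈ I, z i = 0) ∧ ∀ j ∉ J, depth z j = 0 := by
  have h (r : ℝ) (hr : 0 ≤ r) : r ^ 2 ≤ 1 ↔ r ≤ 1 := sq_le_one_iff₀ hr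
  simp [face, orbitMap, depth, sub_eq_zero, eq_comm (a := (1 : ℝ)), h]

/-- The support of the depth vector is a nonempty subset of `J`, hence a simplex itself; the empty
`J` contributes only the torus over the apex. -/
theorem mem_openCone_of_ne {J : Finset (Fin m)} {z : Fin m → ℂ} (hz : ∀ i, ‖z i‖ ≤ 1)
    (hJ : IsSimplex K J) (h : ∀ j ∉ J, depth z j = 0) (h0 : depth z ≠ 0) :
    depth z ∈ openCone K := by
  refine ⟨fun i => depth_nonneg_iff.2 (hz i), ?_⟩
  have hsub : Finset.univ.filter (fun i => depth z i ≠ 0) ⊆ J := by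
    intro i hi
    by_contra hiJ
    exact (Finset.mem_filter.1 hi).2 (h i hiJ)
  have hne : (Finset.univ.filter (fun i => depth z i ≠ 0)).Nonempty := by
    obtain ⟨i, hi⟩ := Function.ne_iff.1 h0
    exact ⟨i, by simpa using hi⟩
  rcases hJ with rfl | hJ
  · exact absurd (Finset.subset_empty.1 hsub) hne.ne_empty
  · exact mem_of_subset hJ hsub hne

theorem mem_momentAngleZ_iff {z : Fin m → ℂ} :
    z ∈ momentAngleZ K ↔ depth z = 0 ∨ depth z ∈ openCone K := by
  constructor
  · rintro ⟨hz, I, J, -, hJ, hF⟩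
    by_cases h0 : depth z = 0
    · exact .inl h0
    · exact .inr (mem_openCone_of_ne hz hJ (mem_face_iff.1 hF).2.2 h0)
  · intro h
    have hz : ∀ i, ‖z i‖ ≤ 1 := fun i => depth_nonneg_iff.1 <| by
      rcases h with h | h
      · simp [h]
      · exact h.1 i
    -- The smallest admissible `J` is the support of the depth vector.
    refine ⟨hz, ∅, Finset.univ.filter (fun i => depth z i ≠ 0), by simp, ?_,
      mem_face_iff.2 ⟨hz, by simp, by simp⟩⟩
    rcases h with h | h
    · left; simp [h]
    · exact .inr h.2

theorem mem_singularTorus_iff {z : Fin m → ℂ} : z ∈ singularTorus m ↔ depth z = 0 := by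
  constructor
  · rintro ⟨-, h⟩
    rw [← l2_eq_zero, ← dist_orbitMap_apex, dist_eq_zero]
    exact h
  · intro h
    refine ⟨fun i => depth_nonneg_iff.1 (by simp [h]), ?_⟩
    rw [← l2_eq_zero, ← dist_orbitMap_apex, dist_eq_zero] at h
    exact h

theorem mem_momentAngleW_iff {z : Fin m → ℂ} :
    z ∈ momentAngleW K ↔ depth z ∈ openCone K ∧ ∃ i, z i = 0 := by
  constructor
  · rintro ⟨hz, I, J, ⟨i, hi⟩, -, hJ, hF⟩
    obtain ⟨-, hI, hJ'⟩ := mem_face_iff.1 hF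
    refine ⟨mem_openCone_of_ne hz hJ hJ' fun h0 => ?_, i, hI i hi⟩
    have := depth_eq_one_iff.2 (hI i hi)
    simp [h0] at this
  · rintro ⟨h, i, hi⟩
    have hz : ∀ i, ‖z i‖ ≤ 1 := fun i => depth_nonneg_iff.1 (h.1 i)
    refine ⟨hz, {i}, Finset.univ.filter (fun i => depth z i ≠ 0), by simp, ?_, .inr h.2,
      mem_face_iff.2 ⟨hz, by simpa using hi, by simp⟩⟩
    simp [depth_eq_one_iff.2 hi]

theorem mem_manifoldW_iff {ε : ℝ} (hε : 0 < ε) {z : Fin m → ℂ} :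
    z ∈ manifoldW K ε ↔ depth z ∈ openCone K ∧ ε ≤ l2 (depth z) := by
  have h : z ∈ manifoldW K ε ↔ z ∈ momentAngleZ K ∧ ε ≤ l2 (depth z) := by
    rw [← dist_orbitMap_apex, ← not_lt]
    exact (and_assoc (b := orbitMap z ∈ cc K)).symm
  rw [h, mem_momentAngleZ_iff]
  constructor
  · rintro ⟨h | h, h'⟩
    · rw [l2_eq_zero.2 h] at h'
      linarith
    · exact ⟨h, h'⟩
  · exact fun h => ⟨.inr h.1, h.2⟩

theorem mem_boundaryW_iff {ε : ℝ} (hε : 0 < ε) {z : Fin m → ℂ} :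
    z ∈ boundaryW K ε ↔ depth z ∈ openCone K ∧ l2 (depth z) = ε := by
  have h : z ∈ boundaryW K ε ↔ z ∈ momentAngleZ K ∧ l2 (depth z) = ε := by
    rw [← dist_orbitMap_apex]
    exact (and_assoc (b := orbitMap z ∈ cc K)).symm
  rw [h, mem_momentAngleZ_iff]
  constructor
  · rintro ⟨h | h, h'⟩
    · rw [l2_eq_zero.2 h] at h'
      linarith
    · exact ⟨h, h'⟩
  · exact fun h => ⟨.inr h.1, h.2⟩

theorem momentAngleW_le_manifoldW {ε : ℝ} (hε : 0 < ε) (hε1 : ε < 1) :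
    momentAngleW K ≤ manifoldW K ε := by
  intro z hz
  obtain ⟨h, h'⟩ := mem_momentAngleW_iff.1 hz
  rw [← norm_depth_eq_one_iff h] at h'
  exact (mem_manifoldW_iff hε).2 ⟨h, by linarith [norm_le_l2 (depth z)]⟩

/-! ### Radial motion -/

/-- The point over the point `p + a (ρ(z) - p)` of the ray from the apex through the orbit of `z`
whose coordinates have the same arguments as those of `z`. -/
noncomputable def radial (a : ℝ) (z : Fin m → ℂ) (i : Fin m) : ℂ :=
  (√(1 - a * depth z i) / ‖z i‖ : ℝ) * z i

theorem radial_one (z : Fin m → ℂ) : radial 1 z = z := by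
  ext i
  by_cases h : z i = 0
  · simp [radial, h]
  · simp [radial, depth, h]

theorem radial_smul (a : ℝ) (t : Torus m) (z : Fin m → ℂ) :
    radial a (t • z) = t • radial a z := by
  ext i
  rw [radial, norm_smul_apply, depth_smul, Pi.smul_apply', Pi.smul_apply', radial,
    Circle.smul_def, Circle.smul_def, smul_eq_mul, smul_eq_mul]
  ring

/-- At `z i = 0` the quotient in `radial` is a division by zero and the value is 0. This has the
intended modulus when `a = 1`, which explains the hypothesis here and below. -/
theorem norm_radial {a : ℝ} {z : Fin m → ℂ} {i : Fin m} (h : z i = 0 → a = 1) :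
    ‖radial a z i‖ = √(1 - a * depth z i) := by
  by_cases hz : z i = 0
  · simp [radial, hz, h hz, depth]
  · simp [radial, abs_of_nonneg, hz, Real.sqrt_nonneg]

theorem depth_radial {a : ℝ} {z : Fin m → ℂ} (h : ∀ i, z i = 0 → a = 1)
    (h' : ∀ i, a * depth z i ≤ 1) : depth (radial a z) = a • depth z := by
  ext i
  rw [depth, norm_radial (h i), Real.sq_sqrt (by linarith [h' i])]
  simp

/-- The strict inequality keeps nonzero coordinates nonzero after the first move, so that their
arguments survive for the second. -/
theorem radial_radial {a b : ℝ} {z : Fin m → ℂ} (h : ∀ i, z i = 0 → a = 1)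
    (h' : ∀ i, z i ≠ 0 → a * depth z i < 1) : radial b (radial a z) = radial (b * a) z := by
  have h1 (i : Fin m) : a * depth z i ≤ 1 := by
    by_cases hz : z i = 0
    · rw [h i hz, one_mul]
      exact depth_le_one z i
    · exact (h' i hz).le
  ext i
  by_cases hz : z i = 0
  · simp [radial, hz]
  · have hs : √(1 - a * depth z i) ≠ 0 := (Real.sqrt_pos.2 (by linarith [h' i hz])).ne'
    rw [radial, norm_radial (h i), depth_radial h h1]
    simp only [radial, Pi.smul_apply, smul_eq_mul, ← mul_assoc, ← Complex.ofReal_mul]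
    congr 2
    field_simp

/-- The argument is discontinuous at a vanishing coordinate, but there the factor is 1 and the
modulus `√(1 - a * depth)` tends to 0, which suffices. -/
theorem continuous_radial {X : Type*} [TopologicalSpace X] {a : X → ℝ} {f : X → Fin m → ℂ}
    (ha : Continuous a) (hf : Continuous f) (h : ∀ x i, f x i = 0 → a x = 1) :
    Continuous fun x => radial (a x) (f x) := by
  refine continuous_pi fun i => continuous_iff_continuousAt.2 fun x => ?_
  have hfi : Continuous fun x => f x i := (continuous_apply i).comp hf
  have hs : Continuous fun x => √(1 - a x * depth (f x) i) := by
    unfold depth; fun_prop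
  by_cases hx : f x i = 0
  · rw [ContinuousAt]
    have h0 : radial (a x) (f x) i = 0 := by simp [radial, hx]
    rw [h0, tendsto_zero_iff_norm_tendsto_zero]
    have h1 : (fun y => ‖radial (a y) (f y) i‖) = fun y => √(1 - a y * depth (f y) i) :=
      funext fun y => norm_radial (h y i)
    rw [h1]
    have := hs.tendsto x
    rwa [h x i hx, depth_eq_one_iff.2 hx, one_mul, sub_self, Real.sqrt_zero] at this
  · exact (Complex.continuous_ofReal.continuousAt.comp
      (hs.continuousAt.div hfi.norm.continuousAt (norm_ne_zero_iff.2 hx))).mul hfi.continuousAt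

variable {ε : ℝ}

/-! ### The collapse of `∂W_K` onto the torus over the apex -/

/-- The factor by which the collapse moves the point `x` of the cone towards the vertex: on each
ray it is affine, and takes the segment from the `ε`-sphere to the base onto the segment from the
vertex to the base. -/
noncomputable def collapseFactor (ε : ℝ) (x : Fin m → ℝ) : ℝ := (l2 x - ε) / (l2 x - ε * ‖x‖)

/-- The factor of the inverse of the collapse. -/
noncomputable def expandFactor (ε : ℝ) (x : Fin m → ℝ) : ℝ := (l2 x - ε * ‖x‖ + ε) / l2 x

/-- The collapse of `∂W_K` onto the torus over the apex. -/
noncomputable def collapse (ε : ℝ) (z : Fin m → ℂ) : Fin m → ℂ :=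
  radial (collapseFactor ε (depth z)) z

/-- The inverse of the collapse, away from the torus over the apex. -/
noncomputable def expand (ε : ℝ) (z : Fin m → ℂ) : Fin m → ℂ :=
  radial (expandFactor ε (depth z)) z

theorem l2_sub_pos {x : Fin m → ℝ} (hx : x ∈ openCone K) (hε1 : ε < 1) : 0 < l2 x - ε * ‖x‖ := by
  nlinarith [norm_le_l2 x, norm_pos_of_mem_openCone hx]

theorem collapseFactor_eq_one {x : Fin m → ℝ} (hx : x ∈ openCone K) (hε1 : ε < 1)
    (h : ‖x‖ = 1) : collapseFactor ε x = 1 := by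
  have := l2_sub_pos hx hε1
  rw [collapseFactor, div_eq_one_iff_eq this.ne', h, mul_one]

theorem collapseFactor_nonneg {x : Fin m → ℝ} (hx : x ∈ openCone K) (hε1 : ε < 1)
    (h : ε ≤ l2 x) : 0 ≤ collapseFactor ε x :=
  div_nonneg (by linarith) (l2_sub_pos hx hε1).le

theorem collapseFactor_pos {x : Fin m → ℝ} (hx : x ∈ openCone K) (hε1 : ε < 1)
    (h : ε < l2 x) : 0 < collapseFactor ε x :=
  div_pos (by linarith) (l2_sub_pos hx hε1)

theorem collapseFactor_le_one {x : Fin m → ℝ} (hx : x ∈ openCone K) (hε : 0 < ε) (hε1 : ε < 1)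
    (h : ‖x‖ ≤ 1) : collapseFactor ε x ≤ 1 := by
  rw [collapseFactor, div_le_one (l2_sub_pos hx hε1)]
  nlinarith

theorem expandFactor_pos {x : Fin m → ℝ} (hx : x ∈ openCone K) (hε : 0 < ε) (hε1 : ε < 1) :
    0 < expandFactor ε x :=
  div_pos (by linarith [l2_sub_pos hx hε1]) (l2_pos_of_mem_openCone hx)

theorem expandFactor_eq_one {x : Fin m → ℝ} (hx : x ∈ openCone K) (h : ‖x‖ = 1) :
    expandFactor ε x = 1 := by
  rw [expandFactor, div_eq_one_iff_eq (l2_pos_of_mem_openCone hx).ne', h]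
  ring

theorem expandFactor_mul_norm_lt_one {x : Fin m → ℝ} (hx : x ∈ openCone K) (hε1 : ε < 1)
    (h : ‖x‖ < 1) : expandFactor ε x * ‖x‖ < 1 := by
  rw [expandFactor, div_mul_eq_mul_div, div_lt_one (l2_pos_of_mem_openCone hx)]
  -- The difference of the two sides is `(1 - ‖x‖) * (l2 x - ε * ‖x‖)`.
  nlinarith [mul_pos (sub_pos.2 h) (l2_sub_pos hx hε1)]

/-- On a ray the ratio `κ = ‖x‖ / l2 x` is constant. In terms of `r = l2 x` the collapse is `r ↦ (r
- ε) / (1 - ε * κ)` and the expansion is `r ↦ (1 - ε * κ) * r + ε`, its inverse. -/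
theorem collapseFactor_expand {x : Fin m → ℝ} (hx : x ∈ openCone K) (hε : 0 < ε) (hε1 : ε < 1) :
    collapseFactor ε (expandFactor ε x • x) * expandFactor ε x = 1 := by
  have hσ := expandFactor_pos hx hε hε1
  have hd := l2_sub_pos hx hε1
  have hN := l2_pos_of_mem_openCone hx
  rw [collapseFactor, l2_smul _ hσ.le, norm_smul, Real.norm_of_nonneg hσ.le]
  have h1 : expandFactor ε x * l2 x = l2 x - ε * ‖x‖ + ε := div_mul_cancel₀ _ hN.ne'
  rw [show expandFactor ε x * l2 x - ε * (expandFactor ε x * ‖x‖) =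
    expandFactor ε x * (l2 x - ε * ‖x‖) by ring, h1]
  field_simp
  ring

theorem expandFactor_collapse {x : Fin m → ℝ} (hx : x ∈ openCone K) (hε1 : ε < 1)
    (h : ε < l2 x) : expandFactor ε (collapseFactor ε x • x) * collapseFactor ε x = 1 := by
  have hs := collapseFactor_pos hx hε1 h
  have hd := l2_sub_pos hx hε1
  have hN := l2_pos_of_mem_openCone hx
  rw [expandFactor, l2_smul _ hs.le, norm_smul, Real.norm_of_nonneg hs.le]
  have h1 : collapseFactor ε x * (l2 x - ε * ‖x‖) = l2 x - ε := div_mul_cancel₀ _ hd.ne'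
  rw [show collapseFactor ε x * l2 x - ε * (collapseFactor ε x * ‖x‖) + ε =
    collapseFactor ε x * (l2 x - ε * ‖x‖) + ε by ring, h1]
  field_simp
  ring

section

variable {z : Fin m → ℂ} (hz : depth z ∈ openCone K)
include hz

theorem collapseFactor_eq_one_of_apply_eq_zero (hε1 : ε < 1) (i : Fin m) (hi : z i = 0) :
    collapseFactor ε (depth z) = 1 :=
  collapseFactor_eq_one hz hε1 ((norm_depth_eq_one_iff hz).2 ⟨i, hi⟩)

theorem expandFactor_eq_one_of_apply_eq_zero (i : Fin m) (hi : z i = 0) :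
    expandFactor ε (depth z) = 1 :=
  expandFactor_eq_one hz ((norm_depth_eq_one_iff hz).2 ⟨i, hi⟩)

theorem collapseFactor_mul_depth_le (hε : 0 < ε) (hε1 : ε < 1) (i : Fin m) :
    collapseFactor ε (depth z) * depth z i ≤ depth z i :=
  mul_le_of_le_one_left (hz.1 i) (collapseFactor_le_one hz hε hε1 (norm_depth_le_one hz))

theorem depth_collapse (hε : 0 < ε) (hε1 : ε < 1) :
    depth (collapse ε z) = collapseFactor ε (depth z) • depth z :=
  depth_radial (collapseFactor_eq_one_of_apply_eq_zero hz hε1)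
    fun i => (collapseFactor_mul_depth_le hz hε hε1 i).trans (depth_le_one z i)

theorem expandFactor_mul_depth_lt_one (hε : 0 < ε) (hε1 : ε < 1) (i : Fin m) (hi : z i ≠ 0) :
    expandFactor ε (depth z) * depth z i < 1 := by
  have hi' : depth z i < 1 := (depth_le_one z i).lt_of_ne fun h => hi (depth_eq_one_iff.1 h)
  rcases (norm_depth_le_one hz).eq_or_lt with h | h
  · rwa [expandFactor_eq_one hz h, one_mul]
  · exact (mul_le_mul_of_nonneg_left (apply_le_norm _ i) (expandFactor_pos hz hε hε1).le).trans_lt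
      (expandFactor_mul_norm_lt_one hz hε1 h)

theorem depth_expand (hε : 0 < ε) (hε1 : ε < 1) :
    depth (expand ε z) = expandFactor ε (depth z) • depth z := by
  refine depth_radial (expandFactor_eq_one_of_apply_eq_zero hz) fun i => ?_
  by_cases hi : z i = 0
  · rw [expandFactor_eq_one_of_apply_eq_zero hz i hi, one_mul]
    exact depth_le_one z i
  · exact (expandFactor_mul_depth_lt_one hz hε hε1 i hi).le

theorem expand_collapse (hε : 0 < ε) (hε1 : ε < 1) (h : ε < l2 (depth z)) :
    expand ε (collapse ε z) = z := by
  rw [expand, depth_collapse hz hε hε1, collapse, radial_radial, expandFactor_collapse hz hε1 h,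
    radial_one]
  · exact collapseFactor_eq_one_of_apply_eq_zero hz hε1
  · exact fun i hi => (collapseFactor_mul_depth_le hz hε hε1 i).trans_lt
      ((depth_le_one z i).lt_of_ne fun h => hi (depth_eq_one_iff.1 h))

theorem collapse_expand (hε : 0 < ε) (hε1 : ε < 1) : collapse ε (expand ε z) = z := by
  rw [collapse, depth_expand hz hε hε1, expand, radial_radial, collapseFactor_expand hz hε hε1,
    radial_one]
  · exact expandFactor_eq_one_of_apply_eq_zero hz
  · exact expandFactor_mul_depth_lt_one hz hε hε1

end

theorem collapse_smul (t : Torus m) (z : Fin m → ℂ) : collapse ε (t • z) = t • collapse ε z := by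
  rw [collapse, depth_smul, radial_smul, collapse]

theorem collapse_of_mem_momentAngleW (hε1 : ε < 1) {z : Fin m → ℂ} (hz : z ∈ momentAngleW K) :
    collapse ε z = z := by
  obtain ⟨hz, i, hi⟩ := mem_momentAngleW_iff.1 hz
  rw [collapse, collapseFactor_eq_one_of_apply_eq_zero hz hε1 i hi, radial_one]

theorem orbitMap_collapse_mem_segment (hε : 0 < ε) (hε1 : ε < 1) {z : Fin m → ℂ}
    (hz : z ∈ manifoldW K ε) : orbitMap (collapse ε z) ∈ segment ℝ (apex m) (orbitMap z) := by
  obtain ⟨hz, hN⟩ := (mem_manifoldW_iff hε).1 hz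
  refine ⟨1 - collapseFactor ε (depth z), collapseFactor ε (depth z), ?_,
    collapseFactor_nonneg hz hε1 hN, by ring, ?_⟩
  · linarith [collapseFactor_le_one hz hε hε1 (norm_depth_le_one hz)]
  · ext i
    have := congrFun (depth_collapse hz hε hε1) i
    simp only [depth, Pi.smul_apply, smul_eq_mul] at this
    simp only [apex, orbitMap, PiLp.add_apply, PiLp.smul_apply, smul_eq_mul]
    linarith

theorem continuous_collapse {X : Type*} [TopologicalSpace X] {f : X → Fin m → ℂ}
    (hf : Continuous f) (h : ∀ x, depth (f x) ∈ openCone K) (hε1 : ε < 1) :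
    Continuous fun x => collapse ε (f x) := by
  refine continuous_radial ?_ hf fun x => collapseFactor_eq_one_of_apply_eq_zero (h x) hε1
  have hd := continuous_depth.comp hf
  exact ((continuous_l2.comp hd).sub continuous_const).div
    ((continuous_l2.comp hd).sub (continuous_const.mul hd.norm)) fun x => (l2_sub_pos (h x) hε1).ne'

theorem continuous_expand {X : Type*} [TopologicalSpace X] {f : X → Fin m → ℂ}
    (hf : Continuous f) (h : ∀ x, depth (f x) ∈ openCone K) :
    Continuous fun x => expand ε (f x) := by
  refine continuous_radial ?_ hf fun x => expandFactor_eq_one_of_apply_eq_zero (h x)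
  have hd := continuous_depth.comp hf
  exact (((continuous_l2.comp hd).sub (continuous_const.mul hd.norm)).add continuous_const).div
    (continuous_l2.comp hd) fun x => (l2_pos_of_mem_openCone (h x)).ne'

theorem mem_manifoldW_diff_iff (hε : 0 < ε) {z : Fin m → ℂ} :
    z ∈ (manifoldW K ε : Set (Fin m → ℂ)) \ boundaryW K ε ↔
      depth z ∈ openCone K ∧ ε < l2 (depth z) := by
  rw [mem_sdiff, SetLike.mem_coe, SetLike.mem_coe, mem_manifoldW_iff hε, mem_boundaryW_iff hε,
    lt_iff_le_and_ne]
  tauto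

theorem mem_momentAngleZ_diff_iff {z : Fin m → ℂ} :
    z ∈ (momentAngleZ K : Set (Fin m → ℂ)) \ singularTorus m ↔ depth z ∈ openCone K := by
  rw [mem_sdiff, SetLike.mem_coe, SetLike.mem_coe, mem_momentAngleZ_iff, mem_singularTorus_iff]
  exact ⟨fun h => h.1.resolve_left h.2, fun h => ⟨.inr h, ne_zero_of_mem_openCone h⟩⟩

theorem collapse_mem_diff (hε : 0 < ε) (hε1 : ε < 1) {z : Fin m → ℂ}
    (hz : z ∈ (manifoldW K ε : Set (Fin m → ℂ)) \ boundaryW K ε) :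
    collapse ε z ∈ (momentAngleZ K : Set (Fin m → ℂ)) \ singularTorus m := by
  obtain ⟨h, h'⟩ := (mem_manifoldW_diff_iff hε).1 hz
  rw [mem_momentAngleZ_diff_iff, depth_collapse h hε hε1]
  exact smul_mem_openCone h (collapseFactor_pos h hε1 h')

theorem expand_mem_diff (hε : 0 < ε) (hε1 : ε < 1) {z : Fin m → ℂ}
    (hz : z ∈ (momentAngleZ K : Set (Fin m → ℂ)) \ singularTorus m) :
    expand ε z ∈ (manifoldW K ε : Set (Fin m → ℂ)) \ boundaryW K ε := by
  have h := mem_momentAngleZ_diff_iff.1 hz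
  have hσ := expandFactor_pos h hε hε1
  rw [mem_manifoldW_diff_iff hε, depth_expand h hε hε1, l2_smul _ hσ.le]
  refine ⟨smul_mem_openCone h hσ, ?_⟩
  rw [expandFactor, div_mul_cancel₀ _ (l2_pos_of_mem_openCone h).ne']
  linarith [l2_sub_pos h hε1]

/-- The collapse, as a homeomorphism from `W_K \ ∂W_K` onto `𝒵_K \ T^m`. -/
noncomputable def collapseHomeomorph (K : PreAbstractSimplicialComplex (Fin m)) (hε : 0 < ε)
    (hε1 : ε < 1) :
    ↥((manifoldW K ε : Set (Fin m → ℂ)) \ boundaryW K ε) ≃ₜ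
      ↥((momentAngleZ K : Set (Fin m → ℂ)) \ singularTorus m) where
  toFun z := ⟨collapse ε z, collapse_mem_diff hε hε1 z.2⟩
  invFun z := ⟨expand ε z, expand_mem_diff hε hε1 z.2⟩
  left_inv z :=
    have h := (mem_manifoldW_diff_iff hε).1 z.2
    Subtype.ext (expand_collapse h.1 hε hε1 h.2)
  right_inv z := Subtype.ext (collapse_expand (mem_momentAngleZ_diff_iff.1 z.2) hε hε1)
  continuous_toFun := (continuous_collapse continuous_subtype_val
    (fun z => ((mem_manifoldW_diff_iff hε).1 z.2).1) hε1).subtype_mk _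
  continuous_invFun := (continuous_expand continuous_subtype_val
    (fun z => mem_momentAngleZ_diff_iff.1 z.2)).subtype_mk _

theorem isRelativeHomeomorph_collapse (K : PreAbstractSimplicialComplex (Fin m)) (hε : 0 < ε)
    (hε1 : ε < 1) :
    IsRelativeHomeomorph (collapse ε) (manifoldW K ε : Set (Fin m → ℂ)) (boundaryW K ε)
      (momentAngleZ K) (singularTorus m) where
  continuousOn := continuousOn_iff_continuous_domRestrict.2 <|
    continuous_collapse continuous_subtype_val (fun z => ((mem_manifoldW_iff hε).1 z.2).1) hε1
  mapsTo z hz := by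
    obtain ⟨h, h'⟩ := (mem_manifoldW_iff hε).1 hz
    rw [SetLike.mem_coe, mem_momentAngleZ_iff, depth_collapse h hε hε1]
    rcases (collapseFactor_nonneg h hε1 h').eq_or_lt with h0 | h0
    · left
      rw [← h0, zero_smul]
    · exact .inr (smul_mem_openCone h h0)
  mapsTo_sub z hz := by
    obtain ⟨h, h'⟩ := (mem_boundaryW_iff hε).1 hz
    rw [SetLike.mem_coe, mem_singularTorus_iff, depth_collapse h hε hε1, collapseFactor, h',
      sub_self, zero_div, zero_smul]
  homeomorph := ⟨collapseHomeomorph K hε hε1, fun _ => rfl⟩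

/-! ### The boundary -/

/-- The argument of a nonzero complex number, as a point of the circle. -/
noncomputable def phase (w : ℂ) (hw : w ≠ 0) : Circle :=
  ⟨w / ‖w‖, mem_sphere_zero_iff_norm.2 (by simp [hw])⟩

theorem coe_phase (w : ℂ) (hw : w ≠ 0) : (phase w hw : ℂ) = w / ‖w‖ := rfl

/-- Each depth is bounded by the Euclidean norm `ε < 1`, whereas a vanishing coordinate has depth 1.
-/
theorem apply_ne_zero_of_mem_boundaryW (hε : 0 < ε) (hε1 : ε < 1) {z : Fin m → ℂ}
    (hz : z ∈ boundaryW K ε) (i : Fin m) : z i ≠ 0 := by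
  intro h
  have := (abs_apply_le_l2 (depth z) i).trans ((mem_boundaryW_iff hε).1 hz).2.le
  rw [depth_eq_one_iff.2 h, abs_one] at this
  linarith

theorem mem_realization_iff {b : Fin m → ℝ} :
    b ∈ realization K ↔ b ∈ openCone K ∧ ∑ i, b i = 1 :=
  ⟨fun h => ⟨⟨h.1, h.2.2⟩, h.2.1⟩, fun h => ⟨h.1.1, h.2, h.1.2⟩⟩

theorem inv_sum_smul_mem_realization {x : Fin m → ℝ} (hx : x ∈ openCone K) :
    (∑ i, x i)⁻¹ • x ∈ realization K := by
  have := sum_pos_of_mem_openCone hx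
  refine mem_realization_iff.2 ⟨smul_mem_openCone hx (inv_pos.2 this), ?_⟩
  simp [← Finset.mul_sum, this.ne']

/-- The point of `∂W_K` with the arguments `t` over the ray through `b`. -/
noncomputable def boundaryPoint (ε : ℝ) (b : Fin m → ℝ) (t : Torus m) (i : Fin m) : ℂ :=
  (√(1 - ε / l2 b * b i) : ℝ) * t i

theorem one_sub_pos (hε : 0 < ε) (hε1 : ε < 1) {b : Fin m → ℝ} (hb : b ∈ openCone K) (i : Fin m) :
    0 < 1 - ε / l2 b * b i := by
  have h := l2_pos_of_mem_openCone hb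
  have h1 : ε / l2 b * b i ≤ ε / l2 b * l2 b :=
    mul_le_mul_of_nonneg_left ((le_abs_self _).trans (abs_apply_le_l2 b i)) (by positivity)
  rw [div_mul_cancel₀ _ h.ne'] at h1
  linarith

theorem norm_boundaryPoint (b : Fin m → ℝ) (t : Torus m) (i : Fin m) :
    ‖boundaryPoint ε b t i‖ = √(1 - ε / l2 b * b i) := by
  rw [boundaryPoint, norm_mul, Circle.norm_coe, mul_one, Complex.norm_of_nonneg (Real.sqrt_nonneg _)]

theorem depth_boundaryPoint (hε : 0 < ε) (hε1 : ε < 1) {b : Fin m → ℝ} (hb : b ∈ openCone K)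
    (t : Torus m) : depth (boundaryPoint ε b t) = (ε / l2 b) • b := by
  ext i
  rw [depth, norm_boundaryPoint, Real.sq_sqrt (one_sub_pos hε hε1 hb i).le]
  simp

theorem boundaryPoint_mem (hε : 0 < ε) (hε1 : ε < 1) {b : Fin m → ℝ} (hb : b ∈ openCone K)
    (t : Torus m) : boundaryPoint ε b t ∈ boundaryW K ε := by
  have h := l2_pos_of_mem_openCone hb
  rw [mem_boundaryW_iff hε, depth_boundaryPoint hε hε1 hb, l2_smul _ (by positivity)]
  exact ⟨smul_mem_openCone hb (by positivity), div_mul_cancel₀ _ h.ne'⟩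

theorem boundaryPoint_div_norm (hε : 0 < ε) (hε1 : ε < 1) {b : Fin m → ℝ} (hb : b ∈ openCone K)
    (t : Torus m) (i : Fin m) :
    boundaryPoint ε b t i / ‖boundaryPoint ε b t i‖ = t i := by
  rw [norm_boundaryPoint, boundaryPoint, mul_div_cancel_left₀]
  exact Complex.ofReal_ne_zero.2 (Real.sqrt_pos.2 (one_sub_pos hε hε1 hb i)).ne'

/-- The homeomorphism `|K| × T^m ≅ ∂W_K`. -/
noncomputable def boundaryHomeomorph (K : PreAbstractSimplicialComplex (Fin m)) (hε : 0 < ε)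
    (hε1 : ε < 1) : realization K × Torus m ≃ₜ boundaryW K ε where
  toFun q := ⟨boundaryPoint ε q.1 q.2, boundaryPoint_mem hε hε1 (mem_realization_iff.1 q.1.2).1 q.2⟩
  invFun z := (⟨(∑ i, depth (z : Fin m → ℂ) i)⁻¹ • depth (z : Fin m → ℂ),
      inv_sum_smul_mem_realization ((mem_boundaryW_iff hε).1 z.2).1⟩,
    fun i => phase ((z : Fin m → ℂ) i) (apply_ne_zero_of_mem_boundaryW hε hε1 z.2 i))
  left_inv := by
    rintro ⟨⟨b, hb⟩, t⟩
    obtain ⟨hb, hb1⟩ := mem_realization_iff.1 hb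
    have h := l2_pos_of_mem_openCone hb
    refine Prod.ext (Subtype.ext ?_) (funext fun i => Circle.ext ?_)
    · simp only [depth_boundaryPoint hε hε1 hb, Pi.smul_apply, smul_eq_mul, ← Finset.mul_sum, hb1,
        mul_one, smul_smul]
      rw [inv_mul_cancel₀ (by positivity), one_smul]
    · exact boundaryPoint_div_norm hε hε1 hb t i
  right_inv := by
    rintro ⟨z, hz⟩
    obtain ⟨h, h'⟩ := (mem_boundaryW_iff hε).1 hz
    have hs := sum_pos_of_mem_openCone h
    refine Subtype.ext (funext fun i => ?_)
    have hi := apply_ne_zero_of_mem_boundaryW hε hε1 hz i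
    simp only [boundaryPoint, coe_phase, l2_smul _ (inv_pos.2 hs).le, h', Pi.smul_apply,
      smul_eq_mul]
    rw [show ε / ((∑ i, depth z i)⁻¹ * ε) * ((∑ i, depth z i)⁻¹ * depth z i) = depth z i by
      field_simp]
    rw [depth, sub_sub_cancel, Real.sqrt_sq (norm_nonneg _), mul_div_cancel₀]
    simpa using hi
  continuous_toFun := by
    refine Continuous.subtype_mk (continuous_pi fun i => ?_) _
    have h1 : Continuous fun q : realization K × Torus m => (q.1 : Fin m → ℝ) := by fun_prop
    have h2 : Continuous fun q : realization K × Torus m => l2 (q.1 : Fin m → ℝ) :=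
      continuous_l2.comp h1
    refine (Complex.continuous_ofReal.comp (Real.continuous_sqrt.comp (continuous_const.sub
      ((continuous_const.div h2 fun q => ?_).mul ((continuous_apply i).comp h1))))).mul ?_
    · exact (l2_pos_of_mem_openCone (mem_realization_iff.1 q.1.2).1).ne'
    · exact continuous_subtype_val.comp ((continuous_apply i).comp continuous_snd)
  continuous_invFun := by
    have hd : Continuous fun z : boundaryW K ε => depth (z : Fin m → ℂ) :=
      continuous_depth.comp continuous_subtype_val
    have hs : Continuous fun z : boundaryW K ε => (∑ i, depth (z : Fin m → ℂ) i)⁻¹ := by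
      refine Continuous.inv₀ ?_ ?_
      · exact continuous_finsetSum _ fun i _ => (continuous_apply i).comp hd
      · exact fun z => (sum_pos_of_mem_openCone ((mem_boundaryW_iff hε).1 z.2).1).ne'
    refine Continuous.prodMk ((hs.smul hd).subtype_mk _) (continuous_pi fun i => ?_)
    have hz : Continuous fun z : boundaryW K ε => (z : Fin m → ℂ) i :=
      (continuous_apply i).comp continuous_subtype_val
    refine continuous_induced_rng.2 (hz.div (Complex.continuous_ofReal.comp hz.norm) fun z => ?_)
    simpa using apply_ne_zero_of_mem_boundaryW hε hε1 z.2 i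

theorem boundaryHomeomorph_mul (hε : 0 < ε) (hε1 : ε < 1) (q : realization K) (s t : Torus m) :
    boundaryHomeomorph K hε hε1 (q, s * t) = s • boundaryHomeomorph K hε hε1 (q, t) := by
  refine Subtype.ext (funext fun i => ?_)
  change boundaryPoint ε q (s * t) i = s i • boundaryPoint ε q t i
  simp only [boundaryPoint, Pi.mul_apply, Circle.coe_mul, Circle.smul_def, smul_eq_mul]
  ring

/-- The collapse factor is 0 on the `ε`-sphere, so `radial` only normalizes each coordinate to
modulus 1. -/
theorem collapse_boundaryHomeomorph (hε : 0 < ε) (hε1 : ε < 1) (q : realization K) (t : Torus m) :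
    collapse ε (boundaryHomeomorph K hε hε1 (q, t)) = fun i => (t i : ℂ) := by
  have hq := (mem_realization_iff.1 q.2).1
  change collapse ε (boundaryPoint ε q t) = _
  have h := ((mem_boundaryW_iff hε).1 (boundaryPoint_mem hε hε1 hq t)).2
  ext i
  rw [collapse, collapseFactor, h, sub_self, zero_div, radial, zero_mul, sub_zero, Real.sqrt_one,
    ← boundaryPoint_div_norm hε hε1 hq t i]
  push_cast
  ring

/-! ### The homotopy equivalence -/

/-- The factor interpolates between `‖depth‖⁻¹` at `a = 0`, which carries a point to the base, and 1
at `a = 1`. -/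
theorem continuous_toCube {X : Type*} [TopologicalSpace X] {a : X → ℝ} {f : X → Fin m → ℂ}
    (ha : Continuous a) (hf : Continuous f) (h : ∀ x, depth (f x) ∈ openCone K) :
    Continuous fun x => radial ((1 - a x) * ‖depth (f x)‖⁻¹ + a x) (f x) := by
  have hd : Continuous fun x => ‖depth (f x)‖ := (continuous_depth.comp hf).norm
  refine continuous_radial (((continuous_const.sub ha).mul (hd.inv₀ fun x => ?_)).add ha) hf ?_
  · exact (norm_pos_of_mem_openCone (h x)).ne'
  · intro x i hi
    rw [(norm_depth_eq_one_iff (h x)).2 ⟨i, hi⟩]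
    ring

theorem depth_toCube {z : Fin m → ℂ} (hz : depth z ∈ openCone K) {a : ℝ} (ha : 0 ≤ a)
    (ha1 : a ≤ 1) : depth (radial ((1 - a) * ‖depth z‖⁻¹ + a) z) =
      ((1 - a) * ‖depth z‖⁻¹ + a) • depth z := by
  have hM := norm_pos_of_mem_openCone hz
  refine depth_radial (fun i hi => ?_) fun i => ?_
  · rw [(norm_depth_eq_one_iff hz).2 ⟨i, hi⟩]
    ring
  · refine (mul_le_mul_of_nonneg_left (apply_le_norm _ i) ?_).trans ?_
    · have : 0 ≤ 1 - a := by linarith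
      positivity
    -- The factor times the sup norm is `(1 - a) + a * ‖depth z‖`, a convex combination of numbers
    -- at most 1.
    · rw [add_mul, mul_assoc, inv_mul_cancel₀ hM.ne']
      nlinarith [norm_depth_le_one hz]

/-- The factor is at least 1, so the motion never approaches the apex. -/
theorem toCube_mem_manifoldW (hε : 0 < ε) {z : Fin m → ℂ}
    (hz : z ∈ manifoldW K ε) {a : ℝ} (ha : 0 ≤ a) (ha1 : a ≤ 1) :
    radial ((1 - a) * ‖depth z‖⁻¹ + a) z ∈ manifoldW K ε := by
  obtain ⟨h, h'⟩ := (mem_manifoldW_iff hε).1 hz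
  have hM := norm_pos_of_mem_openCone h
  have h1 : 1 ≤ ‖depth z‖⁻¹ := (one_le_inv₀ hM).2 (norm_depth_le_one h)
  have h2 : 1 ≤ (1 - a) * ‖depth z‖⁻¹ + a := by nlinarith
  rw [mem_manifoldW_iff hε, depth_toCube h ha ha1, l2_smul _ (by linarith)]
  exact ⟨smul_mem_openCone h (by linarith), h'.trans (le_mul_of_one_le_left (l2_nonneg _) h2)⟩

/-- The unsimplified factor is the value at `a = 0` verbatim, so that the homotopy starts at the
retraction by `rfl`. -/
theorem toCube_mem_momentAngleW {z : Fin m → ℂ} (hz : depth z ∈ openCone K) :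
    radial ((1 - 0) * ‖depth z‖⁻¹ + 0) z ∈ momentAngleW K := by
  have hM := norm_pos_of_mem_openCone hz
  have h := depth_toCube hz le_rfl zero_le_one
  have hc : depth (radial ((1 - 0) * ‖depth z‖⁻¹ + 0) z) ∈ openCone K := by
    rw [h]
    exact smul_mem_openCone hz (by simpa using hM)
  rw [mem_momentAngleW_iff, ← norm_depth_eq_one_iff hc]
  refine ⟨hc, ?_⟩
  rw [h, norm_smul]
  simp [hM.ne']

/-- The retraction of `W_K` onto `𝒲_K` along the rays of the cone. -/
noncomputable def toCube (K : PreAbstractSimplicialComplex (Fin m)) (hε : 0 < ε) :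
    C(manifoldW K ε, momentAngleW K) where
  toFun z := ⟨radial ((1 - 0) * ‖depth (z : Fin m → ℂ)‖⁻¹ + 0) z,
    toCube_mem_momentAngleW ((mem_manifoldW_iff hε).1 z.2).1⟩
  continuous_toFun := (continuous_toCube continuous_const continuous_subtype_val
    fun z => ((mem_manifoldW_iff hε).1 z.2).1).subtype_mk _

/-- The inclusion of `𝒲_K` into `W_K`. -/
noncomputable def ofCube (K : PreAbstractSimplicialComplex (Fin m)) (hε : 0 < ε) (hε1 : ε < 1) :
    C(momentAngleW K, manifoldW K ε) where
  toFun z := ⟨z, momentAngleW_le_manifoldW hε hε1 z.2⟩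
  continuous_toFun := continuous_subtype_val.subtype_mk _

theorem toCube_comp_ofCube (hε : 0 < ε) (hε1 : ε < 1) :
    (toCube K hε).comp (ofCube K hε hε1) = ContinuousMap.id (momentAngleW K) := by
  ext1 z
  refine Subtype.ext ?_
  obtain ⟨h, h'⟩ := mem_momentAngleW_iff.1 z.2
  change radial ((1 - 0) * ‖depth (z : Fin m → ℂ)‖⁻¹ + 0) (z : Fin m → ℂ) = z
  rw [(norm_depth_eq_one_iff h).2 h', inv_one, mul_one, sub_zero, add_zero, radial_one]

/-- The deformation of `W_K` into `𝒲_K` along the rays of the cone. -/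
noncomputable def toCubeHomotopy (K : PreAbstractSimplicialComplex (Fin m)) (hε : 0 < ε)
    (hε1 : ε < 1) :
    ((ofCube K hε hε1).comp (toCube K hε)).Homotopy (ContinuousMap.id (manifoldW K ε)) where
  toFun q := ⟨radial ((1 - (q.1 : ℝ)) * ‖depth (q.2 : Fin m → ℂ)‖⁻¹ + q.1) q.2,
    toCube_mem_manifoldW hε q.2.2 q.1.2.1 q.1.2.2⟩
  continuous_toFun := (continuous_toCube (continuous_subtype_val.comp continuous_fst)
    (continuous_subtype_val.comp continuous_snd)
    fun q => ((mem_manifoldW_iff hε).1 q.2.2).1).subtype_mk _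
  map_zero_left _ := rfl
  map_one_left z := Subtype.ext <| by
    change radial ((1 - 1) * ‖depth (z : Fin m → ℂ)‖⁻¹ + 1) (z : Fin m → ℂ) = z
    rw [sub_self, zero_mul, zero_add, radial_one]

theorem equivariantlyHomotopyEquivalent (K : PreAbstractSimplicialComplex (Fin m)) (hε : 0 < ε)
    (hε1 : ε < 1) :
    EquivariantlyHomotopyEquivalent (Torus m) (manifoldW K ε) (momentAngleW K) := by
  have key (a : ℝ) (t : Torus m) (z : Fin m → ℂ) :
      radial ((1 - a) * ‖depth (t • z)‖⁻¹ + a) (t • z) =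
        t • radial ((1 - a) * ‖depth z‖⁻¹ + a) z := by
    rw [depth_smul, radial_smul]
  refine ⟨toCube K hε, ofCube K hε hε1, toCubeHomotopy K hε hε1,
    (ContinuousMap.Homotopy.refl _).cast (toCube_comp_ofCube hε hε1).symm rfl, ?_, ?_, ?_, ?_⟩
  · exact fun t z => Subtype.ext (key 0 t z)
  · exact fun t z => rfl
  · exact fun t s z => Subtype.ext (key s t z)
  · exact fun t s z => rfl

end MomentAngle

/-! ### Restricting charts to subspaces; charts in the half-space -/

open Set Topology

/-- An open partial homeomorphism that matches the subsets `S` and `T` restricts to them. -/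
theorem OpenPartialHomeomorph.exists_subtype {X Y : Type*} [TopologicalSpace X]
    [TopologicalSpace Y] (e : OpenPartialHomeomorph X Y) {S : Set X} {T : Set Y}
    (h : ∀ x ∈ e.source, x ∈ S ↔ e x ∈ T) {x : X} (hx : x ∈ e.source) (hxS : x ∈ S) :
    ∃ f : OpenPartialHomeomorph S T, (⟨x, hxS⟩ : S) ∈ f.source ∧
      (f ⟨x, hxS⟩ : Y) = e x := by
  classical
  have h' (y : Y) (hy : y ∈ e.target) : e.symm y ∈ S ↔ y ∈ T := by
    rw [h _ (e.map_target hy), e.right_inv hy]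
  -- Outside the source and target, where the matching of `S` and `T` is unknown, the maps take the
  -- base point or its image as default value.
  let F : S → T := fun z => if hz : e z ∈ T then ⟨e z, hz⟩ else ⟨e x, (h x hx).1 hxS⟩
  let G : T → S := fun y => if hy : e.symm y ∈ S then ⟨e.symm y, hy⟩ else ⟨x, hxS⟩
  have hF (z : S) (hz : (z : X) ∈ e.source) : (F z : Y) = e z := by
    simp only [F, dif_pos ((h z hz).1 z.2)]
  have hG (y : T) (hy : (y : Y) ∈ e.target) : (G y : X) = e.symm y := by
    simp only [G, dif_pos ((h' y hy).2 y.2)]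
  refine ⟨{ toFun := F
            invFun := G
            source := Subtype.val ⁻¹' e.source
            target := Subtype.val ⁻¹' e.target
            map_source' := fun z hz => ?_
            map_target' := fun y hy => ?_
            left_inv' := fun z hz => Subtype.ext ?_
            right_inv' := fun y hy => Subtype.ext ?_
            open_source := e.open_source.preimage continuous_subtype_val
            open_target := e.open_target.preimage continuous_subtype_val
            continuousOn_toFun := ?_
            continuousOn_invFun := ?_ }, hx, hF _ hx⟩
  · rw [mem_preimage, hF z hz]
    exact e.map_source hz
  · rw [mem_preimage, hG y hy]
    exact e.map_target hy
  · rw [hG _ (by rw [hF z hz]; exact e.map_source hz), hF z hz, e.left_inv hz]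
  · rw [hF _ (by rw [hG y hy]; exact e.map_target hy), hG y hy, e.right_inv hy]
  · rw [Topology.IsInducing.subtypeVal.continuousOn_iff]
    exact (e.continuousOn.comp continuous_subtype_val.continuousOn fun _ hz => hz).congr hF
  · rw [Topology.IsInducing.subtypeVal.continuousOn_iff]
    exact (e.symm.continuousOn.comp continuous_subtype_val.continuousOn fun _ hy => hy).congr hG

/-- The half-space as a product of Euclidean spaces with a half-line. -/
noncomputable def EuclideanHalfSpace.prodHomeomorph (m d : ℕ) :
    (EuclideanSpace ℝ (Fin d) × Ici (0 : ℝ)) × (Fin m → ℝ) ≃ₜ EuclideanHalfSpace (m + d + 1) where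
  -- The half-line goes to coordinate 0, the one that is nonnegative on the half-space.
  toFun p := ⟨WithLp.toLp 2 (Fin.cons (p.1.2 : ℝ) (Fin.append p.2 p.1.1.ofLp)), p.1.2.2⟩
  invFun y := ((WithLp.toLp 2 fun i => y.1 (Fin.succ (Fin.natAdd m i)), ⟨y.1 0, y.2⟩),
    fun j => y.1 (Fin.succ (Fin.castAdd d j)))
  left_inv p := by
    refine Prod.ext (Prod.ext ?_ (Subtype.ext ?_)) ?_
    · ext i
      simp
    · simp
    · ext j
      simp
  right_inv y := by
    refine Subtype.ext ?_
    ext k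
    refine Fin.cases (by simp) (fun k => ?_) k
    refine Fin.addCases (fun j => ?_) (fun i => ?_) k <;> simp
  continuous_toFun := by
    refine Continuous.subtype_mk ((PiLp.continuous_toLp 2 _).comp (continuous_pi fun k => ?_)) _
    refine Fin.cases (by simpa using by fun_prop) (fun k => ?_) k
    refine Fin.addCases (fun j => ?_) (fun i => ?_) k
    · simpa using by fun_prop
    · simpa using by fun_prop
  continuous_invFun := by
    have h (k : Fin (m + d + 1)) : Continuous fun y : EuclideanHalfSpace (m + d + 1) => y.1 k := by
      exact (by fun_prop : Continuous fun y : EuclideanSpace ℝ (Fin (m + d + 1)) => y k).comp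
        continuous_subtype_val
    exact Continuous.prodMk (Continuous.prodMk ((PiLp.continuous_toLp 2 _).comp
      (continuous_pi fun i => h _)) ((h 0).subtype_mk _)) (continuous_pi fun j => h _)

/-- A space is a manifold with boundary `B` when every point has a chart in the half-space that
takes it to the bounding hyperplane exactly if it lies in `B`. -/
theorem isTopologicalManifoldWithBoundary_of_exists {n : ℕ} [NeZero n] {X : Type*}
    [TopologicalSpace X] [T2Space X] [SecondCountableTopology X] {B : Set X}
    (h : ∀ x : X, ∃ e : OpenPartialHomeomorph X (EuclideanHalfSpace n),
      x ∈ e.source ∧ ((e x).1 0 = 0 ↔ x ∈ B)) :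
    IsTopologicalManifoldWithBoundary n X B := by
  choose e he hB using h
  refine ⟨inferInstance, inferInstance,
    { atlas := range e
      chartAt := e
      mem_chart_source := he
      chart_mem_atlas := mem_range_self }, ?_⟩
  ext x
  -- Being a boundary point is tested in the preferred chart `e x` at `x` itself, so no invariance
  -- of domain is needed.
  rw [← hB x]
  change _ ∈ frontier (range (𝓡∂ n)) ↔ _
  rw [frontier_range_modelWithCornersEuclideanHalfSpace]
  exact eq_comm

namespace MomentAngle

variable {m : ℕ} {K : PreAbstractSimplicialComplex (Fin m)} {ε : ℝ}

/-! ### Charts -/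

/-- Near a nonzero complex number, `1 - |w|²` is the first of two local coordinates. -/
theorem exists_chart_of_ne_zero {z : ℂ} (hz : z ≠ 0) :
    ∃ e : OpenPartialHomeomorph ℂ (ℝ × ℝ), z ∈ e.source ∧ ∀ w ∈ e.source, (e w).1 = 1 - ‖w‖ ^ 2 := by
  have ha : 0 < ‖z‖ := norm_pos_iff.2 hz
  let s : OpenPartialHomeomorph ℝ ℝ :=
    { toFun := fun r => 1 - (‖z‖ * r) ^ 2
      invFun := fun x => √(1 - x) / ‖z‖
      source := Ioi 0
      target := Iio 1
      map_source' := fun r hr => by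
        have : 0 < ‖z‖ * r := mul_pos ha hr
        simp only [mem_Iio, sub_lt_self_iff]
        positivity
      map_target' := fun x hx => div_pos (Real.sqrt_pos.2 (sub_pos.2 hx)) ha
      left_inv' := fun r hr => by
        rw [sub_sub_cancel, Real.sqrt_sq (mul_pos ha hr).le, mul_div_cancel_left₀ _ ha.ne']
      right_inv' := fun x hx => by
        rw [mul_div_cancel₀ _ ha.ne', Real.sq_sqrt (sub_pos.2 hx).le, sub_sub_cancel]
      open_source := isOpen_Ioi
      open_target := isOpen_Iio
      continuousOn_toFun := by fun_prop
      continuousOn_invFun := by fun_prop }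
  -- Division by `z` moves the point to 1, away from the slit of the polar coordinates; `s` restores
  -- the factor `‖z‖` in the radius.
  let e := ((Homeomorph.mulLeft₀ z⁻¹ (inv_ne_zero hz)).toOpenPartialHomeomorph.trans
    Complex.polarCoord).trans (s.prod (OpenPartialHomeomorph.refl ℝ))
  refine ⟨e, ?_, fun w _ => ?_⟩
  · simp [e, s, hz, Complex.polarCoord_source, Complex.polarCoord_apply]
  · simp only [e, s, OpenPartialHomeomorph.coe_trans, Function.comp_apply,
      OpenPartialHomeomorph.prod_apply]
    change 1 - (‖z‖ * (Complex.polarCoord (z⁻¹ * w)).1) ^ 2 = _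
    rw [Complex.polarCoord_apply, norm_mul, norm_inv, mul_inv_cancel_left₀ ha.ne']

/-- Near zero, there are local coordinates of which the first is at least `1`. -/
theorem exists_chart_zero (hε1 : ε < 1) :
    ∃ e : OpenPartialHomeomorph ℂ (ℝ × ℝ), 0 ∈ e.source ∧
      ∀ w ∈ e.source, 1 ≤ (e w).1 ∧ ε < 1 - ‖w‖ ^ 2 ∧ ‖w‖ < 1 := by
  have hU : IsOpen {w : ℂ | ε < 1 - ‖w‖ ^ 2 ∧ ‖w‖ < 1} :=
    IsOpen.and (isOpen_lt (by fun_prop) (by fun_prop)) (isOpen_lt (by fun_prop) (by fun_prop))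
  -- In the unit disk the real part is at least -1, so a shift by 2 makes the first coordinate at
  -- least 1.
  let e := ((Complex.equivRealProdCLM.toHomeomorph.trans
    (Homeomorph.addRight ((2, 0) : ℝ × ℝ))).toOpenPartialHomeomorph.restrOpen
      {w | ε < 1 - ‖w‖ ^ 2 ∧ ‖w‖ < 1} hU)
  refine ⟨e, ⟨mem_univ _, by simpa using hε1⟩, fun w hw => ⟨?_, hw.2⟩⟩
  have h1 := (abs_le.1 (Complex.abs_re_le_norm w)).1
  change 1 ≤ w.re + 2
  linarith [hw.2.2]

/-- Near every point of the polydisk there are local coordinates, half of which exhibit `W_K` as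
the part of the open cone over `|K|` outside the open `ε`-ball. -/
theorem exists_cone_chart (K : PreAbstractSimplicialComplex (Fin m)) (hε : 0 < ε) (hε1 : ε < 1)
    (z₀ : Fin m → ℂ) :
    ∃ e : OpenPartialHomeomorph (Fin m → ℂ) (Fin m → ℝ × ℝ), z₀ ∈ e.source ∧
      ∀ z ∈ e.source,
        (z ∈ manifoldW K ε ↔
          (fun i => (e z i).1) ∈ openCone K ∧ ε ≤ l2 fun i => (e z i).1) ∧
        (z ∈ boundaryW K ε ↔
          (fun i => (e z i).1) ∈ openCone K ∧ l2 (fun i => (e z i).1) = ε) := by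
  have hc (i : Fin m) : ∃ e : OpenPartialHomeomorph ℂ (ℝ × ℝ), z₀ i ∈ e.source ∧
      ∀ w ∈ e.source, (e w).1 = 1 - ‖w‖ ^ 2 ∨ (1 ≤ (e w).1 ∧ ε < 1 - ‖w‖ ^ 2) := by
    by_cases hi : z₀ i = 0
    · obtain ⟨e, he, he'⟩ := exists_chart_zero hε1
      exact ⟨e, hi ▸ he, fun w hw => .inr ⟨(he' w hw).1, (he' w hw).2.1⟩⟩
    · obtain ⟨e, he, he'⟩ := exists_chart_of_ne_zero hi
      exact ⟨e, he, fun w hw => .inl (he' w hw)⟩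
  choose e he hc using hc
  refine ⟨OpenPartialHomeomorph.pi e, fun i _ => he i, fun z hz => ?_⟩
  rw [mem_manifoldW_iff hε, mem_boundaryW_iff hε]
  change (_ ↔ (fun i => (e i (z i)).1) ∈ _ ∧ ε ≤ l2 fun i => (e i (z i)).1) ∧
    (_ ↔ (fun i => (e i (z i)).1) ∈ _ ∧ l2 (fun i => (e i (z i)).1) = ε)
  set x : Fin m → ℝ := fun i => (e i (z i)).1
  have hxc (i : Fin m) : x i = depth z i ∨ (1 ≤ x i ∧ ε < depth z i) :=
    hc i (z i) (hz i (mem_univ i))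
  by_cases hall : ∀ i, x i = depth z i
  · rw [show x = depth z from funext hall]
    exact ⟨Iff.rfl, Iff.rfl⟩
  · push Not at hall
    obtain ⟨i, hi⟩ := hall
    obtain ⟨h1, h2⟩ := (hxc i).resolve_left hi
    -- If a shifted coordinate occurs, both vectors lie strictly outside the `ε`-ball, so only
    -- membership in the cone matters. It depends on signs and supports alone, and these agree
    -- because the replaced entries are positive on both sides.
    have hx1 : ε < l2 x := by linarith [(le_abs_self _).trans (abs_apply_le_l2 x i)]
    have hx2 : ε < l2 (depth z) := h2.trans_le ((le_abs_self _).trans (abs_apply_le_l2 _ i))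
    have hcone : depth z ∈ openCone K ↔ x ∈ openCone K := by
      have hpos (j : Fin m) : 0 ≤ depth z j ↔ 0 ≤ x j := by
        rcases hxc j with h | ⟨h, h'⟩
        · rw [h]
        · exact iff_of_true (by linarith) (by linarith)
      have hne (j : Fin m) : depth z j ≠ 0 ↔ x j ≠ 0 := by
        rcases hxc j with h | ⟨h, h'⟩
        · rw [h]
        · exact iff_of_true (by linarith) (by linarith)
      simp only [openCone, mem_ofPred_eq, hpos, hne]
    simp only [hcone, hx1.le, hx2.le, hx1.ne', hx2.ne', and_true, and_false, and_self]

theorem l2_div_smul {b : Fin m → ℝ} (hb : b ∈ openCone K) {a : ℝ} (ha : 0 < a) :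
    l2 ((a / l2 b) • b) = a := by
  have h := l2_pos_of_mem_openCone hb
  rw [l2_smul _ (div_pos ha h).le, div_mul_cancel₀ _ h.ne']

/-- The product of `Fin m → ℝ` and the part of the cone outside the open `ε`-ball. -/
def outerCone (K : PreAbstractSimplicialComplex (Fin m)) (ε : ℝ) : Set (Fin m → ℝ × ℝ) :=
  {p | (fun i => (p i).1) ∈ openCone K ∧ ε ≤ l2 fun i => (p i).1}

theorem mem_outerCone_of_mem_realization (hε : 0 < ε) {b : Fin m → ℝ} (hb : b ∈ realization K)
    {τ : ℝ} (hτ : τ ∈ Ici 0) (v : Fin m → ℝ) :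
    (fun i => (((τ + ε) / l2 b) * b i, v i)) ∈ outerCone K ε := by
  have hb := (mem_realization_iff.1 hb).1
  have h : 0 < τ + ε := by linarith [mem_Ici.1 hτ]
  have h1 : (fun i => ((τ + ε) / l2 b) * b i) = ((τ + ε) / l2 b) • b := rfl
  rw [outerCone, mem_ofPred_eq, h1, l2_div_smul hb h]
  exact ⟨smul_mem_openCone hb (div_pos h (l2_pos_of_mem_openCone hb)), by linarith [mem_Ici.1 hτ]⟩

/-- The part of the cone outside the open `ε`-ball is `|K| × [0, ∞)`. -/
noncomputable def coneHomeomorph (K : PreAbstractSimplicialComplex (Fin m)) (hε : 0 < ε) :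
    outerCone K ε ≃ₜ (realization K × Ici (0 : ℝ)) × (Fin m → ℝ) where
  -- Rescaling to coordinate sum 1 gives the point of `|K|`; the half-line coordinate `l2 - ε`
  -- vanishes exactly on the `ε`-sphere.
  toFun p := ((⟨(∑ i, (p.1 i).1)⁻¹ • fun i => (p.1 i).1, inv_sum_smul_mem_realization p.2.1⟩,
    ⟨l2 (fun i => (p.1 i).1) - ε, sub_nonneg.2 p.2.2⟩), fun i => (p.1 i).2)
  invFun q := ⟨fun i => (((q.1.2 : ℝ) + ε) / l2 (q.1.1 : Fin m → ℝ) * (q.1.1 : Fin m → ℝ) i, q.2 i),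
    mem_outerCone_of_mem_realization hε q.1.1.2 q.1.2.2 q.2⟩
  left_inv := by
    rintro ⟨p, hp, hp'⟩
    have hs := sum_pos_of_mem_openCone hp
    have hl := l2_pos_of_mem_openCone hp
    refine Subtype.ext (funext fun i => Prod.ext ?_ rfl)
    simp only [l2_smul _ (inv_pos.2 hs).le, Pi.smul_apply, smul_eq_mul, sub_add_cancel]
    field_simp
  right_inv := by
    rintro ⟨⟨⟨b, hb⟩, τ, hτ⟩, v⟩
    obtain ⟨hq, hb1⟩ := mem_realization_iff.1 hb
    have h := l2_pos_of_mem_openCone hq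
    have h' : 0 < τ + ε := by linarith [mem_Ici.1 hτ]
    refine Prod.ext (Prod.ext (Subtype.ext ?_) (Subtype.ext ?_)) rfl
    · ext i
      simp only [Pi.smul_apply, smul_eq_mul, ← Finset.mul_sum, hb1]
      field_simp
    · change l2 (((τ + ε) / l2 b) • b) - ε = τ
      rw [l2_div_smul hq h', add_sub_cancel_right]
  continuous_toFun := by
    have hx : Continuous fun p : outerCone K ε => fun i => (p.1 i).1 :=
      continuous_pi fun i => continuous_fst.comp ((continuous_apply i).comp continuous_subtype_val)
    have hv : Continuous fun p : outerCone K ε => fun i => (p.1 i).2 :=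
      continuous_pi fun i => continuous_snd.comp ((continuous_apply i).comp continuous_subtype_val)
    have hs : Continuous fun p : outerCone K ε => (∑ i, (p.1 i).1)⁻¹ :=
      Continuous.inv₀ (continuous_finsetSum _ fun i _ => (continuous_apply i).comp hx)
        fun p => (sum_pos_of_mem_openCone p.2.1).ne'
    exact (((hs.smul hx).subtype_mk _).prodMk
      (((continuous_l2.comp hx).sub continuous_const).subtype_mk _)).prodMk hv
  continuous_invFun := by
    have hb : Continuous fun q : (realization K × Ici (0 : ℝ)) × (Fin m → ℝ) =>
        (q.1.1 : Fin m → ℝ) := by fun_prop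
    have hτ : Continuous fun q : (realization K × Ici (0 : ℝ)) × (Fin m → ℝ) => (q.1.2 : ℝ) + ε := by
      fun_prop
    have ha := (hτ.div (continuous_l2.comp hb)
        fun q => (l2_pos_of_mem_openCone (mem_realization_iff.1 q.1.1.2).1).ne').smul hb
    exact Continuous.subtype_mk (continuous_pi fun i => ((continuous_apply i).comp ha).prodMk
      ((continuous_apply i).comp continuous_snd)) _

theorem isTopologicalManifoldWithBoundary_manifoldW {d : ℕ} (hε : 0 < ε) (hε1 : ε < 1)
    (hK : IsTopologicalManifold d (realization K)) :
    IsTopologicalManifoldWithBoundary (m + d + 1) (manifoldW K ε)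
      {z : manifoldW K ε | (z : Fin m → ℂ) ∈ boundaryW K ε} := by
  obtain ⟨-, -, ⟨_⟩⟩ := hK
  refine isTopologicalManifoldWithBoundary_of_exists fun z => ?_
  obtain ⟨e, hze, he⟩ := exists_cone_chart K hε hε1 (z : Fin m → ℂ)
  obtain ⟨f, hzf, hf⟩ := e.exists_subtype (S := (manifoldW K ε : Set (Fin m → ℂ)))
    (T := outerCone K ε)
    (fun w hw => (he w hw).1) hze z.2
  have hfz := (f ⟨z, z.2⟩).2
  let q := coneHomeomorph K hε (f ⟨z, z.2⟩)
  let g := ((chartAt (EuclideanSpace ℝ (Fin d)) q.1.1).prod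
    (OpenPartialHomeomorph.refl (Ici (0 : ℝ)))).prod (OpenPartialHomeomorph.refl (Fin m → ℝ))
  refine ⟨((f.transHomeomorph (coneHomeomorph K hε)).trans g).transHomeomorph
    (EuclideanHalfSpace.prodHomeomorph m d), ⟨hzf, ?_⟩, ?_⟩
  · exact ⟨⟨mem_chart_source _ q.1.1, mem_univ _⟩, mem_univ _⟩
  -- Coordinate 0 of the composite chart unfolds to the half-line coordinate `l2 - ε`.
  · change l2 (fun i => ((f ⟨z, z.2⟩ : Fin m → ℝ × ℝ) i).1) - ε = 0 ↔ (z : Fin m → ℂ) ∈ boundaryW K ε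
    rw [(he z hze).2, sub_eq_zero, ← hf]
    exact ⟨fun h => ⟨hfz.1, h⟩, fun h => h.2⟩

end MomentAngle

theorem mainTheorem5 (m : ℕ) (ε : ℝ) (hε : 0 < ε) (hε1 : ε < 1) :
    (∀ (d : ℕ) (K : PreAbstractSimplicialComplex (Fin m)),
      IsTopologicalManifold d (MomentAngle.realization K) →
        IsTopologicalManifoldWithBoundary (m + d + 1) (MomentAngle.manifoldW K ε)
          {z : MomentAngle.manifoldW K ε | (z : Fin m → ℂ) ∈ MomentAngle.boundaryW K ε} ∧
        EquivariantlyHomotopyEquivalent (MomentAngle.Torus m)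
          (MomentAngle.manifoldW K ε) (MomentAngle.momentAngleW K)) ∧
    -- one map `c`, independent of `K`, gives the canonical relative isomorphism for every `K`
    ∃ c : (Fin m → ℂ) → (Fin m → ℂ),
      ∀ (d : ℕ) (K : PreAbstractSimplicialComplex (Fin m)),
        IsTopologicalManifold d (MomentAngle.realization K) →
          IsRelativeHomeomorph c
            (MomentAngle.manifoldW K ε : Set (Fin m → ℂ))
            (MomentAngle.boundaryW K ε : Set (Fin m → ℂ))
            (MomentAngle.momentAngleZ K : Set (Fin m → ℂ))
            (MomentAngle.singularTorus m : Set (Fin m → ℂ)) ∧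
          -- it is equivariant, moves points along the rays of the cone, and fixes `𝒲_K`
          (∀ (t : MomentAngle.Torus m), ∀ z ∈ MomentAngle.manifoldW K ε, c (t • z) = t • c z) ∧
          (∀ z ∈ MomentAngle.manifoldW K ε, MomentAngle.orbitMap (c z) ∈
            segment ℝ (MomentAngle.apex m) (MomentAngle.orbitMap z)) ∧
          (∀ z ∈ MomentAngle.momentAngleW K, c z = z) ∧
          -- on the boundary `∂W_K = |K| × T^m` it is the projection to `T^m`
          ∃ φ : MomentAngle.realization K × MomentAngle.Torus m ≃ₜ MomentAngle.boundaryW K ε,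
            (∀ (q : MomentAngle.realization K) (s t : MomentAngle.Torus m),
              φ (q, s * t) = s • φ (q, t)) ∧
            ∀ (q : MomentAngle.realization K) (t : MomentAngle.Torus m),
              c (φ (q, t)) = fun i => (t i : ℂ) := by
  refine ⟨fun d K hK => ⟨MomentAngle.isTopologicalManifoldWithBoundary_manifoldW hε hε1 hK,
    MomentAngle.equivariantlyHomotopyEquivalent K hε hε1⟩, MomentAngle.collapse ε, fun d K _ =>
    ⟨MomentAngle.isRelativeHomeomorph_collapse K hε hε1,
      fun t z _ => MomentAngle.collapse_smul t z,
      fun z hz => MomentAngle.orbitMap_collapse_mem_segment hε hε1 hz,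
      fun z hz => MomentAngle.collapse_of_mem_momentAngleW hε1 hz,
      MomentAngle.boundaryHomeomorph K hε hε1, ?_, ?_⟩⟩
  · exact MomentAngle.boundaryHomeomorph_mul hε hε1
  · exact MomentAngle.collapse_boundaryHomeomorph hε hε1
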